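/- A maximal plane $3$-tree $H$ is a triangle, or arises from one by repeatedly placing a new vertex inside an inner triangular face and joining it to the three vertices of that face. Peel $H$ into levels: $L_0$ consists of the vertices on the outer face, and $L_{i+1}$ of the vertices on the outer face of $H-(L_0\cup\dots\cup L_i)$; let $H_i$ be the subgraph of $H$ induced by $L_i$. Every connected component of $H_{j+1}$ resides in a triangular inner face of $H_j$. Consider a linear layout of $H$ obtained as follows. Every connected component of every $H_i$ is augmented by edges to a maximal outerplane graph, which is drawn incrementally with straight-line edges: start with a single edge whose endpoints differ by $1$ in height (for a one-vertex component, a single point); this edge remains the lower envelope, while the upper envelope is an $x$-monotone path. Then repeatedly add a new vertex $v$ above an edge $(u,w)$ of the upper envelope, horizontally strictly between $u$ and $w$, and join it to $u$ and $w$: if the heights of $u$ and $w$ differ by $1$, then $y(v)=\max\{y(u),y(w)\}+1$; if they differ by $2$, then $y(v)=\max\{y(u),y(w)\}-1$. Hence the vertices of every triangular face of $H_i$ have heights $h+2,h+1,h$ for some $h$; they are called the top, middle and bottom vertex of the face. The vertex order $\prec$ places $L_j$ before $L_{j+1}$ for all $j$; inside a component the vertices are ordered by decreasing height and, at equal height,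 from left to right; two distinct components of $H_{j+1}$ are ordered as the middle vertices of the faces of $H_j$ in which they reside, ties being broken by the top and then by the bottom vertices. A level edge is assigned to $\mathcal Q_0$ or $\mathcal Q_1$ if its endpoints differ in height by $1$ or $2$, respectively. An edge $(u,v)$ with $u\in L_j$ and $v\in L_{j+1}$ is assigned to $\mathcal Q_2$, $\mathcal Q_3$ or $\mathcal Q_4$ if $u$ is the top, middle or bottom vertex, respectively, of the face of $H_j$ in which the component of $H_{j+1}$ containing $v$ resides. For $u\in L_j$ let $N_k(u)$ be the set of the neighbors of $u$ in $L_{j+1}$ that are joined to $u$ by an edge of $\mathcal Q_k$. Then, for every $j$ and every $u\in L_j$: all vertices of $N_3(u)$ precede all vertices of $N_2(u)$ in $\prec$; the vertices of $N_2(u)$ belong to at most two connected components of $H_{j+1}$, and so do the vertices of $N_3(u)$; and distinct components of $H_{j+1}$ that contain vertices of $N_2(u)\cup N_3(u)$ reside in distinct faces of $H_j$. -/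

import Mathlib

/-- `PlaneStack a b c W G F`: the plane graph `G` with vertex set `W`, whose outer face is the
triangle `a b c` and whose inner faces are the vertex triples in `F`, arises from the triangle
`a b c` by repeatedly placing a new vertex of degree three inside an inner face. -/
inductive PlaneStack {V : Type*} (a b c : V) : Set V → SimpleGraph V → Set (Set V) → Prop
  | triangle (hab : a ≠ b) (hbc : b ≠ c) (hac : a ≠ c) :
      PlaneStack a b c {a, b, c}
        (SimpleGraph.edge a b ⊔ SimpleGraph.edge b c ⊔ SimpleGraph.edge a c)
        {{a, b, c}}
  | stack {W : Set V} {G : SimpleGraph V} {F : Set (Set V)} (x y z v : V)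
      (h : PlaneStack a b c W G F) (hface : ({x, y, z} : Set V) ∈ F) (hv : v ∉ W) :
      PlaneStack a b c (insert v W)
        (G ⊔ SimpleGraph.edge x v ⊔ SimpleGraph.edge y v ⊔ SimpleGraph.edge z v)
        ((F \ {{x, y, z}}) ∪ {{x, y, v}, {y, z, v}, {x, z, v}})

/-- A maximal plane 3-tree with vertex set `V`: a maximal planar 3-tree together with a
combinatorial embedding, given by its faces. The outer face is the triangle `a b c`. -/
structure MaximalPlane3Tree (V : Type*) where
  a : V
  b : V
  c : V
  graph : SimpleGraph V
  innerFaces : Set (Set V)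
  built : PlaneStack a b c Set.univ graph innerFaces

namespace MaximalPlane3Tree

variable {V : Type*} (H : MaximalPlane3Tree V)

/-- The vertices on the outer face. -/
def outerFace : Set V := {H.a, H.b, H.c}

/-- All faces of `H`, each given by its three vertices. -/
def faces : Set (Set V) := insert H.outerFace H.innerFaces

/-- Two faces of `H` with a common vertex `s ∈ S` become parts of one face of `H - S`. -/
def Merge (S : Set V) (f g : Set V) : Prop :=
  f ∈ H.faces ∧ g ∈ H.faces ∧ ∃ s ∈ S, s ∈ f ∧ s ∈ g

/-- The face of the plane graph `H - S` that contains the face `f` of `H`, given as the set of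
those faces of `H` of which it consists. -/
def faceOfDeletion (S : Set V) (f : Set V) : Set (Set V) :=
  {g | Relation.ReflTransGen (H.Merge S) f g}

/-- The vertices of `H - S` that are incident to the outer face of `H - S`. -/
def outerVertices (S : Set V) : Set V :=
  {v | v ∉ S ∧ ∃ f ∈ H.faceOfDeletion S H.outerFace, v ∈ f}

/-- The vertices `L_0 ∪ ⋯ ∪ L_{i-1}` that have been peeled off before level `i`. -/
def peeled : ℕ → Set V
  | 0 => ∅
  | i + 1 => peeled i ∪ H.outerVertices (peeled i)

/-- The level `L_i` of the peeling: the vertices on the outer face of `H - (L_0 ∪ ⋯ ∪ L_{i-1})`. -/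
def level (i : ℕ) : Set V := H.outerVertices (H.peeled i)

/-- The subgraph `H_i` of `H` induced by the level `L_i`. -/
def levelGraph (i : ℕ) : SimpleGraph (H.level i) := H.graph.induce (H.level i)

/-- `u` and `v` are vertices of level `L_i` in the same connected component of `H_i`. -/
def SameComponent (i : ℕ) (u v : V) : Prop :=
  ∃ (hu : u ∈ H.level i) (hv : v ∈ H.level i), (H.levelGraph i).Reachable ⟨u, hu⟩ ⟨v, hv⟩

/-- The face of the plane graph `H_i` in which a vertex `v ∉ L_i` resides, given as the set of
those faces of `H` of which it consists. -/
def residence (i : ℕ) (v : V) : Set (Set V) :=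
  {g | ∃ f ∈ H.faces, v ∈ f ∧ g ∈ H.faceOfDeletion (H.level i)ᶜ f}

/-- The vertices of `H_i` on the boundary of the face of `H_i` in which `v ∉ L_i` resides. -/
def residenceBoundary (i : ℕ) (v : V) : Set V :=
  {u | u ∈ H.level i ∧ ∃ g ∈ H.residence i v, u ∈ g}

end MaximalPlane3Tree

/-- `EnvelopeDrawing x y env G`: the coordinates `x`, `y` give a straight-line drawing of the
maximal outerplane graph `G` on the vertices in `env` produced by the incremental algorithm that
keeps the lower envelope a single edge. The list `env` is the upper envelope from left to right;
the lower envelope is the edge between its ends. A new vertex `v` is put above an edge `u w`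
of the upper envelope: one unit above the higher endpoint if `u w` has span one, at the middle
height if `u w` has span two. -/
inductive EnvelopeDrawing {V : Type*} (x : V → ℝ) (y : V → ℤ) : List V → SimpleGraph V → Prop
  | vertex (v : V) : EnvelopeDrawing x y [v] ⊥
  | edge (u w : V) (hx : x u < x w) (hy : |y u - y w| = 1) :
      EnvelopeDrawing x y [u, w] (SimpleGraph.edge u w)
  | add {l₁ l₂ : List V} {u w : V} {G : SimpleGraph V} (v : V)
      (h : EnvelopeDrawing x y (l₁ ++ u :: w :: l₂) G) (hv : v ∉ l₁ ++ u :: w :: l₂)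
      (hux : x u < x v) (hxw : x v < x w)
      (hy : (|y u - y w| = 1 ∧ y v = max (y u) (y w) + 1) ∨
        (|y u - y w| = 2 ∧ y v = max (y u) (y w) - 1))
      (habove : ((y w : ℝ) - y u) * (x v - x u) < ((y v : ℝ) - y u) * (x w - x u)) :
      EnvelopeDrawing x y (l₁ ++ u :: v :: w :: l₂)
        (G ⊔ SimpleGraph.edge u v ⊔ SimpleGraph.edge v w)

/-- The vertex `v ∉ L_j` resides in a triangular face of `H_j` whose top, middle and bottom
vertices, with respect to the heights `y`, are `t`, `m` and `b`. -/
def MaximalPlane3Tree.FaceRoles {V : Type*} (H : MaximalPlane3Tree V) (y : V → ℤ) (j : ℕ)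
    (v t m b : V) : Prop :=
  H.residenceBoundary j v = {t, m, b} ∧ y t = y m + 1 ∧ y m = y b + 1

/-- A linear layout of `H` produced by the modified peeling-into-levels algorithm. -/
structure PeelingLayout {V : Type*} (H : MaximalPlane3Tree V) where
  /-- The coordinates in the drawings of the connected components of `H_0, H_1, …`; each component
  has a drawing of its own. -/
  x : V → ℝ
  y : V → ℤ
  /-- Each connected component of each `H_j`, augmented by edges to a maximal outerplane graph, is
  drawn by the modified outerplanar algorithm. -/
  drawing : ∀ (j : ℕ) (C : (H.levelGraph j).ConnectedComponent),
    ∃ (env : List V) (G : SimpleGraph V), EnvelopeDrawing x y env G ∧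
      (∀ v : V, v ∈ env ↔ ∃ hv : v ∈ H.level j,
        (H.levelGraph j).connectedComponentMk ⟨v, hv⟩ = C) ∧
      (∀ v ∈ env, ∀ w ∈ env, H.graph.Adj v w → G.Adj v w)
  /-- The vertex order. -/
  prec : V → V → Prop
  total : IsStrictTotalOrder V prec
  /-- The levels come one after the other. -/
  prec_of_level_lt : ∀ (i j : ℕ) (u v : V), u ∈ H.level i → v ∈ H.level j → i < j → prec u v
  /-- In a component, the order is from top to bottom, and from left to right at equal height. -/
  prec_iff_of_sameComponent : ∀ (j : ℕ) (u v : V), H.SameComponent j u v →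
    (prec u v ↔ y v < y u ∨ (y u = y v ∧ x u < x v))
  /-- Distinct components of `H_{j+1}` are ordered as the middle vertices of the faces of `H_j` in
  which they reside; ties are broken by the top and then by the bottom vertices. -/
  prec_iff_of_not_sameComponent : ∀ (j : ℕ) (v v' t m b t' m' b' : V),
    v ∈ H.level (j + 1) → v' ∈ H.level (j + 1) → ¬ H.SameComponent (j + 1) v v' →
    H.FaceRoles y j v t m b → H.FaceRoles y j v' t' m' b' →
    (prec v v' ↔ prec m m' ∨ (m = m' ∧ (prec t t' ∨ (t = t' ∧ prec b b'))))

namespace PeelingLayout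

variable {V : Type*} {H : MaximalPlane3Tree V} (Γ : PeelingLayout H)

/-- `Γ.InQueue k u v`: the edge `u v` is assigned to the queue `Q_k`. Level edges go to `Q_0` and
`Q_1` according to their span. A binding edge from `u ∈ L_j` to `v ∈ L_{j+1}` goes to `Q_2`, `Q_3`
or `Q_4` if `u` is the top, middle or bottom vertex of the face of `H_j` in which `v` resides. -/
def InQueue (k : Fin 5) (u v : V) : Prop :=
  H.graph.Adj u v ∧ ∃ j : ℕ, u ∈ H.level j ∧
    match k with
    | 0 => v ∈ H.level j ∧ |Γ.y u - Γ.y v| = 1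
    | 1 => v ∈ H.level j ∧ |Γ.y u - Γ.y v| = 2
    | 2 => v ∈ H.level (j + 1) ∧ ∃ m b, H.FaceRoles Γ.y j v u m b
    | 3 => v ∈ H.level (j + 1) ∧ ∃ t b, H.FaceRoles Γ.y j v t u b
    | 4 => v ∈ H.level (j + 1) ∧ ∃ t m, H.FaceRoles Γ.y j v t m u

/-- The set `N_k(u)` of the neighbors of `u ∈ L_j` in `L_{j+1}` that are joined to `u` by an edge
of the queue `Q_k`. -/
def N (k : Fin 5) (j : ℕ) (u : V) : Set (H.level (j + 1)) := {v | Γ.InQueue k u v}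

end PeelingLayout

/-! The level of a vertex is its distance `ℓ` from the outer triangle, and a vertex of level above
`j` is enclosed by a triangle `R j v` of level-`j` vertices. Both are built along the stacking and
recorded in `LevelData`. Two vertices of `L_{j+1}` lie in the same component exactly when their
regions `R j` agree, equal residences force equal regions, and `R j v = {t, m, b}` once the face has
roles. So distinct components reside in distinct faces.

Counting components then means counting triangles at `u`, with `u` in a fixed role, in the drawing
of the component of `u`. A potential argument (`EnvelopeDrawing.exists_finset`) gives the bound: the
triangles present so far plus suitably weighted envelope edges at `u` never exceed 2.

For the order, a face with middle `u` is compared with a face with top `u`. The middle vertex of the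
latter is a neighbor of `u` lying one unit lower, hence after `u` in the order. -/

/-! ### Levels and enclosing triangles of a stacked triangulation. -/

/-- A level function `ℓ` on a stacked triangulation together with sets `R j v`, the triangle of
level-`j` vertices that encloses a vertex `v` of level greater than `j`. -/
structure LevelData {V : Type*} (O W : Set V) (G : SimpleGraph V) (F : Set (Set V))
    (ℓ : V → ℕ) (R : ℕ → V → Set V) : Prop where
  mem_of_adj : ∀ {p q}, G.Adj p q → p ∈ W
  outer_subset : O ⊆ W
  outer_clique : G.IsClique O
  eq_zero_iff : ∀ {p}, p ∈ W → (ℓ p = 0 ↔ p ∈ O)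
  exists_parent : ∀ {p k}, p ∈ W → ℓ p = k + 1 → ∃ q, G.Adj q p ∧ ℓ q = k
  le_of_adj : ∀ {p q}, G.Adj p q → ℓ q ≤ ℓ p + 1
  face_subset : ∀ {f}, f ∈ F → f ⊆ W
  face_clique : ∀ {f}, f ∈ F → G.IsClique f
  exists_face : ∀ {p}, p ∈ W → ∃ f ∈ F, p ∈ f
  exists_face_of_adj : ∀ {p q}, G.Adj p q → ∃ f ∈ F, p ∈ f ∧ q ∈ f
  region_eq : ∀ {p q j}, G.Adj p q → j < ℓ p → j < ℓ q → R j p = R j q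
  mem_region : ∀ {p q j}, G.Adj p q → ℓ p = j → ℓ q = j + 1 → p ∈ R j q
  region_subset : ∀ {p j}, p ∈ W → j < ℓ p → R j p ⊆ W
  region_clique : ∀ {p j}, p ∈ W → j < ℓ p → G.IsClique (R j p)
  region_encard : ∀ {p j}, p ∈ W → j < ℓ p → (R j p).encard ≤ 3
  connected : ∀ {p q j}, p ∈ W → q ∈ W → ℓ p = j + 1 → ℓ q = j + 1 → R j p = R j q →
    Relation.ReflTransGen (fun s t => G.Adj s t ∧ ℓ s = j + 1 ∧ ℓ t = j + 1) p q
  -- This keeps `connected` inductive: when stacking into a face of level-`j` vertices opens a new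
  -- component, no older vertex has that face as its region.
  region_ne_face : ∀ {f p j}, f ∈ F → (∀ q ∈ f, ℓ q = j) → p ∈ W → j < ℓ p → R j p ≠ f

namespace LevelData

variable {V : Type*} {O W : Set V} {G : SimpleGraph V} {F : Set (Set V)} {ℓ : V → ℕ}
  {R : ℕ → V → Set V}

theorem le_of_mem_clique (D : LevelData O W G F ℓ R) {f : Set V} (hf : G.IsClique f) {p q : V}
    (hp : p ∈ f) (hq : q ∈ f) : ℓ q ≤ ℓ p + 1 := by
  by_cases h : p = q
  · subst h; omega
  · exact D.le_of_adj (hf hp hq h)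

theorem region_eq_of_mem_clique (D : LevelData O W G F ℓ R) {f : Set V} (hf : G.IsClique f)
    {p q : V} {j : ℕ} (hp : p ∈ f) (hq : q ∈ f) (hjp : j < ℓ p) (hjq : j < ℓ q) :
    R j p = R j q := by
  by_cases h : p = q
  · rw [h]
  · exact D.region_eq (hf hp hq h) hjp hjq

/-- All conditions concern vertices of `W` only, so `ℓ` and `R` may be redefined at a vertex about
to be stacked. -/
theorem congr_on (D : LevelData O W G F ℓ R) {ℓ' : V → ℕ} {R' : ℕ → V → Set V}
    (hℓ : ∀ p ∈ W, ℓ' p = ℓ p) (hR : ∀ p ∈ W, ∀ j, R' j p = R j p) :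
    LevelData O W G F ℓ' R' where
  mem_of_adj := D.mem_of_adj
  outer_subset := D.outer_subset
  outer_clique := D.outer_clique
  eq_zero_iff hp := by rw [hℓ _ hp]; exact D.eq_zero_iff hp
  exists_parent hp h := by
    rw [hℓ _ hp] at h
    obtain ⟨q, hq, hk⟩ := D.exists_parent hp h
    exact ⟨q, hq, by rw [hℓ _ (D.mem_of_adj hq)]; exact hk⟩
  le_of_adj h := by
    rw [hℓ _ (D.mem_of_adj h), hℓ _ (D.mem_of_adj h.symm)]; exact D.le_of_adj h
  face_subset := D.face_subset
  face_clique := D.face_clique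
  exists_face := D.exists_face
  exists_face_of_adj := D.exists_face_of_adj
  region_eq h := by
    rw [hℓ _ (D.mem_of_adj h), hℓ _ (D.mem_of_adj h.symm), hR _ (D.mem_of_adj h),
      hR _ (D.mem_of_adj h.symm)]
    exact D.region_eq h
  mem_region h := by
    rw [hℓ _ (D.mem_of_adj h), hℓ _ (D.mem_of_adj h.symm), hR _ (D.mem_of_adj h.symm)]
    exact D.mem_region h
  region_subset hp := by rw [hℓ _ hp, hR _ hp]; exact D.region_subset hp
  region_clique hp := by rw [hℓ _ hp, hR _ hp]; exact D.region_clique hp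
  region_encard hp := by rw [hℓ _ hp, hR _ hp]; exact D.region_encard hp
  connected hp hq := by
    rw [hℓ _ hp, hℓ _ hq, hR _ hp, hR _ hq]
    intro h1 h2 h3
    refine Relation.ReflTransGen.mono (fun s t h => ?_) _ _ (D.connected hp hq h1 h2 h3)
    rw [hℓ _ (D.mem_of_adj h.1), hℓ _ (D.mem_of_adj h.1.symm)]
    exact h
  region_ne_face hf h hp := by
    rw [hℓ _ hp, hR _ hp]
    exact D.region_ne_face hf (fun q hq => by rw [← hℓ _ (D.face_subset hf hq)]; exact h q hq) hp

/-- Stacking a vertex `v` into a face `N`, when `ℓ` and `R` already have the right values at `v`. -/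
theorem stack (D : LevelData O W G F ℓ R) {G' : SimpleGraph V} {F' : Set (Set V)} {N : Set V}
    {v n₀ : V} (hN : N ∈ F) (hv : v ∉ W) (hcard : N.encard ≤ 3)
    (hG : ∀ p q, G'.Adj p q ↔ G.Adj p q ∨ (p ∈ N ∧ q = v) ∨ (q ∈ N ∧ p = v))
    (hF : ∀ f ∈ F', (f ∈ F ∧ f ≠ N) ∨ (v ∈ f ∧ f ⊆ insert v N))
    (hF₁ : ∀ f ∈ F, f ≠ N → f ∈ F')
    (hF₂ : ∀ p ∈ N, ∀ q ∈ N, ∃ f ∈ F', p ∈ f ∧ q ∈ f)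
    (hF₃ : ∀ p ∈ N, ∃ f ∈ F', p ∈ f ∧ v ∈ f)
    (hn₀ : n₀ ∈ N) (hmin : ∀ n ∈ N, ℓ n₀ ≤ ℓ n) (hℓ : ℓ v = ℓ n₀ + 1)
    (hR₁ : ∀ j < ℓ v, ∀ n ∈ N, j < ℓ n → R j v = R j n)
    (hR₂ : ∀ j < ℓ v, (∀ n ∈ N, ℓ n ≤ j) → R j v = N) :
    LevelData O (insert v W) G' F' ℓ R := by
  have hle : G ≤ G' := fun p q h => (hG p q).2 (Or.inl h)
  have hNW := D.face_subset hN
  have hNc := D.face_clique hN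
  have hnv : ∀ n ∈ N, G'.Adj n v := fun n hn => (hG n v).2 (Or.inr (Or.inl ⟨hn, rfl⟩))
  have hmax : ∀ n ∈ N, ℓ n ≤ ℓ n₀ + 1 := fun n hn => D.le_of_mem_clique hNc hn₀ hn
  -- The minimum of `ℓ` on `N` is `ℓ v - 1 ≥ j`; if no vertex of `N` has level above `j`, all have
  -- level exactly `j` and `N` itself encloses `v`.
  have hreg : ∀ j < ℓ v, (∃ n ∈ N, j < ℓ n ∧ R j v = R j n) ∨
      (R j v = N ∧ ∀ n ∈ N, ℓ n = j) := by
    intro j hj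
    by_cases h : ∃ n ∈ N, j < ℓ n
    · obtain ⟨n, hn, hjn⟩ := h
      exact Or.inl ⟨n, hn, hjn, hR₁ j hj n hn hjn⟩
    · push Not at h
      refine Or.inr ⟨hR₂ j hj h, fun n hn => ?_⟩
      have := h n hn
      have := hmin n hn
      omega
  have hfc : ∀ f ∈ F', G'.IsClique f := by
    intro f hf
    rcases hF f hf with h | h
    · exact (D.face_clique h.1).mono hle
    · intro p hp q hq hpq
      rcases h.2 hp with rfl | hp' <;> rcases h.2 hq with rfl | hq'
      · exact absurd rfl hpq
      · exact (hnv q hq').symm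
      · exact hnv p hp'
      · exact hle (hNc hp' hq' hpq)
  -- An older vertex with the region of `v` excludes `R j v = N` by `region_ne_face`. So `v`
  -- inherits its region from some `n ∈ N` of level above `j`, hence of level `j + 1`, through which
  -- `v` joins the old component.
  have hconn : ∀ {q j}, q ∈ W → ℓ v = j + 1 → ℓ q = j + 1 → R j v = R j q →
      ∃ n, (G'.Adj n v ∧ ℓ n = j + 1) ∧ n ∈ W ∧ R j n = R j q := by
    intro q j hq hjv hjq hvq
    rcases hreg j (by omega) with ⟨n, hn, hjn, h⟩ | ⟨h, hall⟩
    · have := hmax n hn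
      exact ⟨n, ⟨hnv n hn, by omega⟩, hNW hn, h ▸ hvq⟩
    · exact absurd (hvq.symm.trans h) (D.region_ne_face hN hall hq (by omega))
  constructor
  · intro p q h
    rcases (hG p q).1 h with h | h | h
    · exact Or.inr (D.mem_of_adj h)
    · exact Or.inr (hNW h.1)
    · exact Or.inl h.2
  · exact D.outer_subset.trans (Set.subset_insert _ _)
  · exact D.outer_clique.mono hle
  · rintro p (rfl | hp)
    · exact ⟨fun h => by omega, fun h => absurd (D.outer_subset h) hv⟩
    · exact D.eq_zero_iff hp
  · rintro p k (rfl | hp) hk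
    · exact ⟨n₀, hnv n₀ hn₀, by omega⟩
    · obtain ⟨q, hq, h⟩ := D.exists_parent hp hk
      exact ⟨q, hle hq, h⟩
  · intro p q h
    rcases (hG p q).1 h with h | ⟨h, rfl⟩ | ⟨h, rfl⟩
    · exact D.le_of_adj h
    · have := hmin p h; omega
    · have := hmax q h; omega
  · intro f hf
    rcases hF f hf with h | h
    · exact (D.face_subset h.1).trans (Set.subset_insert _ _)
    · exact h.2.trans (Set.insert_subset_insert hNW)
  · intro f hf
    exact hfc f hf
  · rintro p (rfl | hp)
    · obtain ⟨f, hf, -, h⟩ := hF₃ n₀ hn₀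
      exact ⟨f, hf, h⟩
    · obtain ⟨f, hf, h⟩ := D.exists_face hp
      by_cases hfN : f = N
      · obtain ⟨g, hg, h', -⟩ := hF₂ p (hfN ▸ h) p (hfN ▸ h)
        exact ⟨g, hg, h'⟩
      · exact ⟨f, hF₁ f hf hfN, h⟩
  · intro p q h
    rcases (hG p q).1 h with h | ⟨h, rfl⟩ | ⟨h, rfl⟩
    · obtain ⟨f, hf, h⟩ := D.exists_face_of_adj h
      by_cases hfN : f = N
      · exact hF₂ p (hfN ▸ h.1) q (hfN ▸ h.2)
      · exact ⟨f, hF₁ f hf hfN, h⟩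
    · exact hF₃ p h
    · obtain ⟨f, hf, h1, h2⟩ := hF₃ q h
      exact ⟨f, hf, h2, h1⟩
  · intro p q j h hp hq
    rcases (hG p q).1 h with h | ⟨h, rfl⟩ | ⟨h, rfl⟩
    · exact D.region_eq h hp hq
    · exact (hR₁ j hq p h hp).symm
    · exact hR₁ j hp q h hq
  · intro p q j h hp hq
    rcases (hG p q).1 h with h | ⟨h, rfl⟩ | ⟨h, rfl⟩
    · exact D.mem_region h hp hq
    · rcases hreg j (by omega) with ⟨n, hn, hjn, h'⟩ | ⟨h', hall⟩
      · rw [h']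
        have := hmax n hn
        refine D.mem_region (hNc h hn ?_) hp (by omega)
        rintro rfl
        omega
      · rw [h']; exact h
    · have := hmax q h
      omega
  · rintro p j (rfl | hp) hj
    · refine Set.Subset.trans ?_ (Set.subset_insert _ _)
      rcases hreg j hj with ⟨n, hn, hjn, h'⟩ | ⟨h', -⟩
      · rw [h']; exact D.region_subset (hNW hn) hjn
      · rw [h']; exact hNW
    · exact (D.region_subset hp hj).trans (Set.subset_insert _ _)
  · rintro p j (rfl | hp) hj
    · refine SimpleGraph.IsClique.mono hle ?_
      rcases hreg j hj with ⟨n, hn, hjn, h'⟩ | ⟨h', -⟩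
      · rw [h']; exact D.region_clique (hNW hn) hjn
      · rw [h']; exact hNc
    · exact (D.region_clique hp hj).mono hle
  · rintro p j (rfl | hp) hj
    · rcases hreg j hj with ⟨n, hn, hjn, h'⟩ | ⟨h', -⟩
      · rw [h']; exact D.region_encard (hNW hn) hjn
      · rw [h']; exact hcard
    · exact D.region_encard hp hj
  · rintro p q j (rfl | hp) (rfl | hq) hjp hjq h
    · exact Relation.ReflTransGen.refl
    · obtain ⟨n, ⟨hn, hjn⟩, hnW, h'⟩ := hconn hq hjp hjq h
      exact Relation.ReflTransGen.head ⟨hn.symm, hjp, hjn⟩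
        (Relation.ReflTransGen.mono (fun s t h => ⟨hle h.1, h.2⟩) _ _ (D.connected hnW hq hjn hjq h'))
    · obtain ⟨n, ⟨hn, hjn⟩, hnW, h'⟩ := hconn hp hjq hjp h.symm
      exact Relation.ReflTransGen.tail
        (Relation.ReflTransGen.mono (fun s t h => ⟨hle h.1, h.2⟩) _ _ (D.connected hp hnW hjp hjn h'.symm)) ⟨hn, hjn, hjq⟩
    · exact Relation.ReflTransGen.mono (fun s t h => ⟨hle h.1, h.2⟩) _ _ (D.connected hp hq hjp hjq h)
  · intro f p j hf hall hp hj
    rcases hF f hf with ⟨hfF, hfN⟩ | ⟨hvf, -⟩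
    · rcases hp with rfl | hp
      · rcases hreg j hj with ⟨n, hn, hjn, h'⟩ | ⟨h', -⟩
        · rw [h']; exact D.region_ne_face hfF hall (hNW hn) hjn
        · rw [h']; exact hfN.symm
      · exact D.region_ne_face hfF hall hp hj
    -- A new face contains `v`, whereas every region consists of older vertices.
    · have : R j p ⊆ W := by
        rcases hp with rfl | hp
        · rcases hreg j hj with ⟨n, hn, hjn, h'⟩ | ⟨h', -⟩
          · rw [h']; exact D.region_subset (hNW hn) hjn
          · rw [h']; exact hNW
        · exact D.region_subset hp hj
      rintro rfl
      exact hv (this hvf)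

end LevelData

-- A stacked vertex gets one plus the least level on its face. Its region is inherited from any
-- vertex of the face of level above `j`, the choice being irrelevant because faces are cliques;
-- without such a vertex, it is the face.
open Classical in
theorem PlaneStack.exists_levelData {V : Type*} {a b c : V} {W : Set V} {G : SimpleGraph V}
    {F : Set (Set V)} (h : PlaneStack a b c W G F) :
    ∃ ℓ R, LevelData {a, b, c} W G F ℓ R := by
  induction h with
  | triangle hab hbc hac =>
    have hclique : (SimpleGraph.edge a b ⊔ SimpleGraph.edge b c ⊔ SimpleGraph.edge a c).IsClique
        {a, b, c} := by
      intro p hp q hq hpq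
      simp only [Set.mem_insert_iff, Set.mem_singleton_iff] at hp hq
      simp only [SimpleGraph.sup_adj, SimpleGraph.edge_adj]
      grind
    have hmem : ∀ {p q}, (SimpleGraph.edge a b ⊔ SimpleGraph.edge b c ⊔ SimpleGraph.edge a c).Adj
        p q → p ∈ ({a, b, c} : Set V) := by
      intro p q h
      simp only [SimpleGraph.sup_adj, SimpleGraph.edge_adj] at h
      simp only [Set.mem_insert_iff, Set.mem_singleton_iff]
      grind
    -- All levels are zero, so the conditions on regions are vacuous and `∅` is a dummy value.
    refine ⟨fun _ => 0, fun _ _ => ∅, ?_⟩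
    constructor
    case mem_of_adj => exact hmem
    case outer_subset => exact subset_rfl
    case outer_clique => exact hclique
    case exists_face => exact fun hp => ⟨_, rfl, hp⟩
    case exists_face_of_adj => exact fun h => ⟨_, rfl, hmem h, hmem h.symm⟩
    case face_subset => rintro f rfl; exact subset_rfl
    case face_clique => rintro f rfl; exact hclique
    all_goals simp
  | @stack W G F x y z v h hface hv ih =>
    obtain ⟨ℓ, R, D⟩ := ih
    set N : Set V := {x, y, z} with hN
    obtain ⟨n₀, hn₀, hmin⟩ := (measure ℓ).wf.has_min N ⟨x, by simp [hN]⟩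
    replace hmin : ∀ n ∈ N, ℓ n₀ ≤ ℓ n := fun n hn => not_lt.1 (hmin n hn)
    have hNW := D.face_subset hface
    have hne : ∀ p ∈ W, p ≠ v := fun p hp e => hv (e ▸ hp)
    let ℓ' : V → ℕ := fun p => if p = v then ℓ n₀ + 1 else ℓ p
    let R' : ℕ → V → Set V := fun j p => if p = v then
      (if h : ∃ n ∈ N, j < ℓ n then R j h.choose else N) else R j p
    have hℓ : ∀ p ∈ W, ℓ' p = ℓ p := fun p hp => if_neg (hne p hp)
    have hR : ∀ p ∈ W, ∀ j, R' j p = R j p := fun p hp j => if_neg (hne p hp)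
    have hxW : x ∈ W := hNW (by simp [hN])
    have hyW : y ∈ W := hNW (by simp [hN])
    have hzW : z ∈ W := hNW (by simp [hN])
    have hxv := hne x hxW
    have hyv := hne y hyW
    have hzv := hne z hzW
    refine ⟨ℓ', R', (D.congr_on hℓ hR).stack (n₀ := n₀) (N := N) hface hv ?_ ?_ ?_ ?_ ?_ ?_ hn₀
      ?_ ?_ ?_ ?_⟩
    · calc N.encard ≤ ({z} : Set V).encard + 1 + 1 :=
            (Set.encard_insert_le _ _).trans (by gcongr; exact Set.encard_insert_le _ _)
        _ = 3 := by rw [Set.encard_singleton]; norm_num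
    · intro p q
      simp only [SimpleGraph.sup_adj, SimpleGraph.edge_adj, hN, Set.mem_insert_iff,
        Set.mem_singleton_iff]
      grind
    · rintro f (hf | hf)
      · exact Or.inl hf
      · right
        rcases hf with rfl | rfl | rfl <;>
          simp only [hN, Set.subset_def, Set.mem_insert_iff, Set.mem_singleton_iff] <;> grind
    · exact fun f hf hfN => Or.inl ⟨hf, hfN⟩
    · have key : ∀ f, f = ({x, y, v} : Set V) ∨ f = {y, z, v} ∨ f = {x, z, v} →
          f ∈ F \ {N} ∪ {{x, y, v}, {y, z, v}, {x, z, v}} := fun f hf => Or.inr hf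
      have h1 := key _ (Or.inl rfl)
      have h2 := key _ (Or.inr (Or.inl rfl))
      have h3 := key _ (Or.inr (Or.inr rfl))
      rintro p (rfl | rfl | rfl) q (rfl | rfl | rfl)
      · exact ⟨_, h1, by simp, by simp⟩
      · exact ⟨_, h1, by simp, by simp⟩
      · exact ⟨_, h3, by simp, by simp⟩
      · exact ⟨_, h1, by simp, by simp⟩
      · exact ⟨_, h1, by simp, by simp⟩
      · exact ⟨_, h2, by simp, by simp⟩
      · exact ⟨_, h3, by simp, by simp⟩
      · exact ⟨_, h2, by simp, by simp⟩
      · exact ⟨_, h3, by simp, by simp⟩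
    · rintro p (rfl | rfl | rfl)
      · exact ⟨{p, y, v}, Or.inr (Or.inl rfl), by simp, by simp⟩
      · exact ⟨{x, p, v}, Or.inr (Or.inl rfl), by simp, by simp⟩
      · exact ⟨{y, p, v}, Or.inr (Or.inr (Or.inl rfl)), by simp, by simp⟩
    · intro n hn
      rw [hℓ _ (hNW hn₀), hℓ _ (hNW hn)]
      exact hmin n hn
    · rw [hℓ _ (hNW hn₀)]
      exact if_pos rfl
    · intro j _ n hn hjn
      rw [hℓ _ (hNW hn)] at hjn
      have hex : ∃ n ∈ N, j < ℓ n := ⟨n, hn, hjn⟩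
      rw [hR _ (hNW hn)]
      have : R' j v = R j hex.choose := by simp only [R', if_true, dif_pos hex]
      rw [this]
      exact D.region_eq_of_mem_clique (D.face_clique hface) hex.choose_spec.1 hn
        hex.choose_spec.2 hjn
    · intro j _ hall
      have hex : ¬ ∃ n ∈ N, j < ℓ n := by
        rintro ⟨n, hn, hjn⟩
        have := hall n hn
        rw [hℓ _ (hNW hn)] at this
        omega
      simp only [R', if_true, dif_neg hex]

/-! ### Counting triangles at a vertex of an envelope drawing. -/

/-- The sum of the weights `c` of the consecutive pairs of a list. -/
def List.pairSum {V : Type*} (c : V → V → ℕ) : List V → ℕ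
  | a :: b :: l => c a b + List.pairSum c (b :: l)
  | _ => 0

theorem List.pairSum_append {V : Type*} (c : V → V → ℕ) (l₁ l₂ : List V) (u : V) :
    (l₁ ++ u :: l₂).pairSum c = (l₁ ++ [u]).pairSum c + (u :: l₂).pairSum c := by
  induction l₁ with
  | nil => simp [List.pairSum]
  | cons a l ih =>
    cases l with
    | nil => simp [List.pairSum]
    | cons b l =>
      simp only [List.cons_append, List.pairSum] at ih ⊢
      omega

theorem List.pairSum_eq_zero {V : Type*} {c : V → V → ℕ} {l : List V}
    (h : ∀ a ∈ l, ∀ b ∈ l, c a b = 0) : l.pairSum c = 0 := by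
  induction l with
  | nil => rfl
  | cons a l ih =>
    cases l with
    | nil => rfl
    | cons b l =>
      rw [List.pairSum, h a (by simp) b (by simp), zero_add]
      exact ih fun a ha b hb => h a (List.mem_cons_of_mem _ ha) b (List.mem_cons_of_mem _ hb)

theorem EnvelopeDrawing.mem_of_adj {V : Type*} {x : V → ℝ} {y : V → ℤ} {env : List V}
    {G : SimpleGraph V} (h : EnvelopeDrawing x y env G) :
    ∀ {p q}, G.Adj p q → p ∈ env := by
  induction h with
  | vertex v => simp
  | edge u w => intro p q h; rw [SimpleGraph.edge_adj] at h; simp; tauto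
  | add v h hv hux hxw hy habove ih =>
    intro p q hpq
    simp only [SimpleGraph.sup_adj, SimpleGraph.edge_adj] at hpq
    have := @ih p q
    simp only [List.mem_append, List.mem_cons] at this ⊢
    tauto

/-- The triangles `p s t` of `G` in which `s` and `t` have heights `δ` and `ε` relative to `p`. -/
def SimpleGraph.trianglesAt {V : Type*} (G : SimpleGraph V) (y : V → ℤ) (δ ε : ℤ) (p : V) :
    Set (V × V) :=
  {q | G.Adj p q.1 ∧ G.Adj p q.2 ∧ G.Adj q.1 q.2 ∧ y q.1 = y p + δ ∧ y q.2 = y p + ε}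

/-- The weights `ω` of the envelope edges at `p` bound the number of future triangles at `p`. -/
noncomputable def endWeight {V : Type*} (y : V → ℤ) (ω : ℤ → ℕ) (p a b : V) : ℕ :=
  open Classical in (if a = p then ω (y b - y p) else 0) + (if b = p then ω (y a - y p) else 0)

-- Each insertion creates a single triangle. If `p` is an end of the covered envelope edge, `hold`
-- says that the weight of this edge pays for the triangle and for the edge replacing it at `p`. If
-- `p` is the inserted vertex, `hnew` bounds its first triangle and its two new envelope edges by 2.
open Classical in
theorem EnvelopeDrawing.exists_finset {V : Type*} {x : V → ℝ} {y : V → ℤ} {env : List V}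
    {G : SimpleGraph V} (h : EnvelopeDrawing x y env G) {δ ε : ℤ} {ω : ℤ → ℕ}
    (hω : ∀ d, ω d ≤ 1)
    (hold : ∀ d e, (|d| = 1 ∧ e = max 0 d + 1) ∨ (|d| = 2 ∧ e = max 0 d - 1) →
      (if (d = δ ∧ e = ε) ∨ (e = δ ∧ d = ε) then 1 else 0) + ω e ≤ ω d)
    (hnew : ∀ d e, (d = -1 ∧ e = -2) ∨ (d = 1 ∧ e = -1) →
      (if (d = δ ∧ e = ε) ∨ (e = δ ∧ d = ε) then 1 else 0) + ω d + ω e ≤ 2) (p : V) :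
    ∃ S : Finset (V × V), G.trianglesAt y δ ε p ⊆ S ∧
      S.card + env.pairSum (endWeight y ω p) ≤ 2 := by
  induction h with
  | vertex v => exact ⟨∅, by simp [SimpleGraph.trianglesAt], by simp [List.pairSum]⟩
  | edge u w hx hy =>
    refine ⟨∅, ?_, ?_⟩
    · rintro ⟨s, t⟩ ⟨h1, h2, h3, -⟩
      simp only [SimpleGraph.edge_adj] at h1 h2 h3
      grind
    · have h1 := hω (y w - y p)
      have h2 := hω (y u - y p)
      simp only [List.pairSum, endWeight, Finset.card_empty]
      split_ifs <;> omega
  | @add l₁ l₂ u w G v h hv hux hxw hy habove ih =>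
    obtain ⟨S, hS, hcard⟩ := ih
    have huv : u ≠ v := by rintro rfl; exact hv (by simp)
    have hwv : w ≠ v := by rintro rfl; exact hv (by simp)
    have huw : u ≠ w := by rintro rfl; exact absurd (hux.trans hxw) (lt_irrefl _)
    have hGv : ∀ q, ¬ G.Adj v q := fun q hq => hv (h.mem_of_adj hq)
    have hadj : ∀ s t, (G ⊔ SimpleGraph.edge u v ⊔ SimpleGraph.edge v w).Adj s t ↔
        G.Adj s t ∨ (s = v ∧ (t = u ∨ t = w)) ∨ (t = v ∧ (s = u ∨ s = w)) := by
      intro s t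
      simp only [SimpleGraph.sup_adj, SimpleGraph.edge_adj]
      grind
    -- The weight of the covered edge is added on the left to avoid subtraction in `ℕ`.
    have hsum : ∀ c : V → V → ℕ, (l₁ ++ u :: v :: w :: l₂).pairSum c + c u w =
        (l₁ ++ u :: w :: l₂).pairSum c + c u v + c v w := by
      intro c
      rw [List.pairSum_append, List.pairSum_append c l₁ (w :: l₂)]
      simp only [List.pairSum]
      omega
    have hs := hsum (endWeight y ω p)
    -- Since `s` and `t` have different heights, at most one of the two orders of the pair fits `δ`
    -- and `ε`, so one triangle costs at most one element.
    have extend : ∀ (s t : V) (S : Finset (V × V)),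
        (∀ q ∈ (G ⊔ SimpleGraph.edge u v ⊔ SimpleGraph.edge v w).trianglesAt y δ ε p,
          q ∈ S ∨ q = (s, t) ∨ q = (t, s)) → y s ≠ y t →
        ∃ S' : Finset (V × V), (G ⊔ SimpleGraph.edge u v ⊔ SimpleGraph.edge v w).trianglesAt
          y δ ε p ⊆ S' ∧ S'.card ≤ S.card + (if (y s - y p = δ ∧ y t - y p = ε) ∨
            (y t - y p = δ ∧ y s - y p = ε) then 1 else 0) := by
      intro s t S hst hne
      by_cases h1 : y s - y p = δ ∧ y t - y p = ε
      · refine ⟨insert (s, t) S, fun q hq => ?_, ?_⟩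
        · have hq' := hq.2.2.2
          rcases hst q hq with h | rfl | rfl
          · exact Finset.mem_coe.2 (Finset.mem_insert_of_mem h)
          · simp
          · exact absurd (by simp only at hq'; omega) hne
        · rw [if_pos (Or.inl h1)]; exact Finset.card_insert_le _ _
      · by_cases h2 : y t - y p = δ ∧ y s - y p = ε
        · refine ⟨insert (t, s) S, fun q hq => ?_, ?_⟩
          · have hq' := hq.2.2.2
            rcases hst q hq with h | rfl | rfl
            · exact Finset.mem_coe.2 (Finset.mem_insert_of_mem h)
            · exact absurd (by simp only at hq'; omega) hne
            · simp
          · rw [if_pos (Or.inr h2)]; exact Finset.card_insert_le _ _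
        · refine ⟨S, fun q hq => ?_, by omega⟩
          have hq' := hq.2.2.2
          rcases hst q hq with h | rfl | rfl
          · exact h
          · exact absurd ⟨by simp only at hq'; omega, by simp only at hq'; omega⟩ h1
          · exact absurd ⟨by simp only at hq'; omega, by simp only at hq'; omega⟩ h2
    have hcases : (y v - y u = 1 ∧ y v - y w = 2) ∨ (y v - y u = 2 ∧ y v - y w = 1) ∨
        (y v - y u = 1 ∧ y v - y w = -1) ∨ (y v - y u = -1 ∧ y v - y w = 1) := by
      rcases hy with hy | hy <;> rcases max_cases (y u) (y w) with hm | hm <;>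
        rcases abs_cases (y u - y w) with ha | ha <;> omega
    have hold' : ∀ a b, (y a = y u ∧ y b = y w) ∨ (y a = y w ∧ y b = y u) →
        (|y b - y a| = 1 ∧ y v - y a = max 0 (y b - y a) + 1) ∨
        (|y b - y a| = 2 ∧ y v - y a = max 0 (y b - y a) - 1) := by
      intro a b hab
      rcases max_cases 0 (y b - y a) with hm | hm <;>
        rcases abs_cases (y b - y a) with ha | ha <;> omega
    by_cases hpv : p = v
    · subst hpv
      obtain ⟨S', hS', hc⟩ := extend u w ∅ (by
        rintro ⟨s, t⟩ ⟨h1, h2, h3, -⟩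
        have hst := h3.ne
        have h1' := h1.ne
        have h2' := h2.ne
        rw [hadj] at h1 h2
        simp only [hGv, false_or, true_and] at h1 h2 hst h1' h2'
        simp only [Prod.mk.injEq]
        grind only) (by omega)
      have h0 : (l₁ ++ u :: w :: l₂).pairSum (endWeight y ω p) = 0 := by
        refine List.pairSum_eq_zero fun a ha b hb => ?_
        rw [endWeight, if_neg, if_neg]
        · rintro rfl; exact hv hb
        · rintro rfl; exact hv ha
      refine ⟨S', hS', ?_⟩
      simp only [endWeight, if_neg huv, if_neg hwv, if_true] at hs
      have h1 := hnew (y u - y p) (y w - y p)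
      have h2 := hnew (y w - y p) (y u - y p)
      rw [Finset.card_empty] at hc
      rcases hcases with h | h | h | h
      · have := h1 (by omega); split_ifs at this hc <;> omega
      · have := h2 (by omega); split_ifs at this hc <;> omega
      · have := h2 (by omega); split_ifs at this hc <;> omega
      · have := h1 (by omega); split_ifs at this hc <;> omega
    have hGp : ∀ q, ¬ G.Adj q v := fun q hq => hGv q hq.symm
    by_cases hpu : p = u
    · subst hpu
      obtain ⟨S', hS', hc⟩ := extend w v S (by
        rintro ⟨s, t⟩ ⟨h1, h2, h3, h4⟩
        have hst := h3.ne
        have h1' := h1.ne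
        have h2' := h2.ne
        rw [hadj] at h1 h2 h3
        by_cases hG : G.Adj p s ∧ G.Adj p t ∧ G.Adj s t
        · exact Or.inl (hS ⟨hG.1, hG.2.1, hG.2.2, h4⟩)
        · right
          simp only [Prod.mk.injEq]
          simp only at h1 h2 h3 hst h1' h2'
          clear extend hsum hs hold hnew hS
          grind only) (by omega)
      refine ⟨S', hS', ?_⟩
      simp only [endWeight, if_neg huw.symm, if_neg (Ne.symm hpv), if_true] at hs
      have := hold _ _ (hold' p w (Or.inl ⟨rfl, rfl⟩))
      split_ifs at this hc <;> omega
    by_cases hpw : p = w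
    · subst hpw
      obtain ⟨S', hS', hc⟩ := extend u v S (by
        rintro ⟨s, t⟩ ⟨h1, h2, h3, h4⟩
        have hst := h3.ne
        have h1' := h1.ne
        have h2' := h2.ne
        rw [hadj] at h1 h2 h3
        by_cases hG : G.Adj p s ∧ G.Adj p t ∧ G.Adj s t
        · exact Or.inl (hS ⟨hG.1, hG.2.1, hG.2.2, h4⟩)
        · right
          simp only [Prod.mk.injEq]
          simp only at h1 h2 h3 hst h1' h2'
          clear extend hsum hs hold hnew hS
          grind only) (by omega)
      refine ⟨S', hS', ?_⟩
      simp only [endWeight, if_neg huw, if_neg (Ne.symm hpv), if_true] at hs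
      have := hold _ _ (hold' p u (Or.inr ⟨rfl, rfl⟩))
      split_ifs at this hc <;> omega
    · refine ⟨S, ?_, ?_⟩
      · rintro ⟨s, t⟩ ⟨h1, h2, h3, h4⟩
        rw [hadj] at h1 h2 h3
        refine hS ⟨?_, ?_, ?_, h4⟩
        all_goals
          simp only at h1 h2 h3 ⊢
          clear extend hsum hs hold hnew hS
          grind only
      · simp only [endWeight, if_neg (Ne.symm hpv), if_neg (Ne.symm hpu),
          if_neg (Ne.symm hpw)] at hs
        omega

/-- Only an envelope edge descending by 2 from `p` can still receive a triangle with top `p`, so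
exactly these edges get weight 1. -/
theorem EnvelopeDrawing.exists_finset_top {V : Type*} {x : V → ℝ} {y : V → ℤ} {env : List V}
    {G : SimpleGraph V} (h : EnvelopeDrawing x y env G) (p : V) :
    ∃ S : Finset (V × V), G.trianglesAt y (-1) (-2) p ⊆ S ∧ S.card ≤ 2 := by
  obtain ⟨S, hS, hc⟩ := h.exists_finset (δ := -1) (ε := -2)
    (ω := fun d => if d = -2 then 1 else 0) (fun d => by split_ifs <;> omega)
    (fun d e hde => by
      have hd := max_cases 0 d
      have ha := abs_cases d
      split_ifs <;> omega)
    (fun d e hde => by split_ifs <;> omega) p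
  exact ⟨S, hS, by omega⟩

/-- Covering an edge that descends by 1 from `p` yields a triangle with middle `p` and leaves an
ascending edge of weight 0. Covering one that descends by 2 yields none but leaves an edge
descending by 1, so both kinds need weight 1. -/
theorem EnvelopeDrawing.exists_finset_middle {V : Type*} {x : V → ℝ} {y : V → ℤ} {env : List V}
    {G : SimpleGraph V} (h : EnvelopeDrawing x y env G) (p : V) :
    ∃ S : Finset (V × V), G.trianglesAt y 1 (-1) p ⊆ S ∧ S.card ≤ 2 := by
  obtain ⟨S, hS, hc⟩ := h.exists_finset (δ := 1) (ε := -1)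
    (ω := fun d => if d = -2 ∨ d = -1 then 1 else 0) (fun d => by split_ifs <;> omega)
    (fun d e hde => by
      have hd := max_cases 0 d
      have ha := abs_cases d
      split_ifs <;> omega)
    (fun d e hde => by split_ifs <;> omega) p
  exact ⟨S, hS, by omega⟩

/-! ### Levels, residences and components in terms of `ℓ` and `R`. -/

namespace MaximalPlane3Tree

variable {V : Type*} {H : MaximalPlane3Tree V} {ℓ : V → ℕ} {R : ℕ → V → Set V}

theorem exists_levelData (H : MaximalPlane3Tree V) :
    ∃ ℓ R, LevelData H.outerFace Set.univ H.graph H.innerFaces ℓ R :=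
  H.built.exists_levelData

theorem isClique_of_mem_faces (D : LevelData H.outerFace Set.univ H.graph H.innerFaces ℓ R)
    {f : Set V} (hf : f ∈ H.faces) : H.graph.IsClique f := by
  rcases hf with rfl | hf
  · exact D.outer_clique
  · exact D.face_clique hf

/-- By induction on the level, a face containing `s` and a parent of `s` already belongs to the
outer face; as `s` is deleted too, all faces at `s` merge with it. -/
theorem mem_faceOfDeletion_outerFace
    (D : LevelData H.outerFace Set.univ H.graph H.innerFaces ℓ R) {S : Set V} {i : ℕ}
    (hS : ∀ v, ℓ v < i → v ∈ S) {k : ℕ} (hk : k < i) :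
    ∀ s, ℓ s = k → ∀ f ∈ H.faces, s ∈ f → f ∈ H.faceOfDeletion S H.outerFace := by
  induction k with
  | zero =>
    intro s hs f hf hsf
    exact Relation.ReflTransGen.single ⟨Or.inl rfl, hf, s, hS s (by omega),
      (D.eq_zero_iff (Set.mem_univ s)).1 hs, hsf⟩
  | succ k ih =>
    intro s hs f hf hsf
    obtain ⟨q, hq, hqk⟩ := D.exists_parent (Set.mem_univ s) hs
    obtain ⟨g, hg, hqg, hsg⟩ := D.exists_face_of_adj hq
    exact Relation.ReflTransGen.tail (ih (by omega) q hqk g (Or.inr hg) hqg)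
      ⟨Or.inr hg, hf, s, hS s (by omega), hsg, hsf⟩

/-- A face at `v` other than the outer one joins the outer face through a deleted vertex of level
below `i` on that face, so `ℓ v ≤ i`. Conversely, for `i > 0` a parent of `v` is deleted and opens a
face at `v`. -/
theorem outerVertices_eq (D : LevelData H.outerFace Set.univ H.graph H.innerFaces ℓ R) (i : ℕ) :
    H.outerVertices {v | ℓ v < i} = {v | ℓ v = i} := by
  ext v
  constructor
  · rintro ⟨hv, f, hf, hvf⟩
    have hv' : ¬ ℓ v < i := hv
    have hle : ℓ v ≤ i := by
      rcases Relation.ReflTransGen.cases_tail hf with rfl | ⟨g, -, -, hfF, s, hs, -, hsf⟩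
      · have := (D.eq_zero_iff (Set.mem_univ v)).2 hvf
        omega
      · have := D.le_of_mem_clique (isClique_of_mem_faces D hfF) hsf hvf
        have hs' : ℓ s < i := hs
        omega
    exact le_antisymm hle (not_lt.1 hv')
  · intro hv
    have hv' : ℓ v = i := hv
    refine ⟨fun h => absurd hv' (ne_of_lt h), ?_⟩
    cases i with
    | zero =>
      exact ⟨H.outerFace, Relation.ReflTransGen.refl, (D.eq_zero_iff (Set.mem_univ v)).1 hv'⟩
    | succ k =>
      obtain ⟨q, hq, hqk⟩ := D.exists_parent (Set.mem_univ v) hv'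
      obtain ⟨g, hg, hqg, hvg⟩ := D.exists_face_of_adj hq
      exact ⟨g, mem_faceOfDeletion_outerFace D (fun _ h => h) (Nat.lt_succ_self k) q hqk g
        (Or.inr hg) hqg, hvg⟩

theorem peeled_eq (D : LevelData H.outerFace Set.univ H.graph H.innerFaces ℓ R) (i : ℕ) :
    H.peeled i = {v | ℓ v < i} := by
  induction i with
  | zero => ext v; simp [peeled]
  | succ i ih =>
    rw [peeled, ih, outerVertices_eq D]
    ext v
    exact Nat.lt_succ_iff_lt_or_eq.symm

theorem mem_level_iff (D : LevelData H.outerFace Set.univ H.graph H.innerFaces ℓ R) {v : V}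
    {i : ℕ} : v ∈ H.level i ↔ ℓ v = i := by
  rw [level, peeled_eq D, outerVertices_eq D]
  rfl

theorem region_of_mem_clique (D : LevelData H.outerFace Set.univ H.graph H.innerFaces ℓ R)
    {f : Set V} (hf : H.graph.IsClique f) {s q : V} {j : ℕ} (hs : s ∈ f) (hjs : j < ℓ s)
    (hq : q ∈ f) : (j < ℓ q ∧ R j q = R j s) ∨ (ℓ q = j ∧ q ∈ R j s) := by
  have hle := D.le_of_mem_clique hf hq hs
  by_cases hjq : j < ℓ q
  · exact Or.inl ⟨hjq, D.region_eq_of_mem_clique hf hq hs hjq hjs⟩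
  · refine Or.inr ⟨by omega, D.mem_region (hf hq hs ?_) (by omega) (by omega)⟩
    rintro rfl
    exact hjq hjs

/-- Faces merge at vertices outside `L_j`. Such a vertex on the chain has level above `j` and the
region of `v`, and it passes this region on to the next face. -/
theorem region_of_mem_residence (D : LevelData H.outerFace Set.univ H.graph H.innerFaces ℓ R)
    {v : V} {j : ℕ} (hv : j < ℓ v) {g : Set V} (hg : g ∈ H.residence j v) :
    ∀ q ∈ g, (j < ℓ q ∧ R j q = R j v) ∨ (ℓ q = j ∧ q ∈ R j v) := by
  obtain ⟨f, hf, hvf, hfg⟩ := hg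
  have hfg' : Relation.ReflTransGen (H.Merge (H.level j)ᶜ) f g := hfg
  clear hfg
  induction hfg' with
  | refl => exact fun q hq => region_of_mem_clique D (isClique_of_mem_faces D hf) hvf hv hq
  | tail _ h ih =>
    obtain ⟨-, hg', s, hs, hsg, hsg'⟩ := h
    rcases ih s hsg with ⟨hjs, h⟩ | ⟨hjs, -⟩
    · rw [← h]
      exact fun q hq => region_of_mem_clique D (isClique_of_mem_faces D hg') hsg' hjs hq
    · exact absurd ((mem_level_iff D).2 hjs) hs

/-- The boundary of the residence is contained in the region. Three distinct heights give three
vertices, and the region has at most three. -/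
theorem region_eq_of_faceRoles (D : LevelData H.outerFace Set.univ H.graph H.innerFaces ℓ R)
    {y : V → ℤ} {v t m b : V} {j : ℕ} (hv : v ∈ H.level (j + 1)) (h : H.FaceRoles y j v t m b) :
    R j v = {t, m, b} := by
  obtain ⟨hB, htm, hmb⟩ := h
  have hjv : j < ℓ v := by rw [(mem_level_iff D).1 hv]; exact Nat.lt_succ_self j
  have hcard := D.region_encard (Set.mem_univ v) hjv
  have hsub : {t, m, b} ⊆ R j v := by
    rw [← hB]
    rintro q ⟨hq, g, hg, hqg⟩
    rcases region_of_mem_residence D hjv hg q hqg with h | h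
    · exact absurd ((mem_level_iff D).1 hq) (ne_of_gt h.1)
    · exact h.2
  have hfin : (R j v).Finite := Set.finite_of_encard_le_coe (k := 3) hcard
  refine ((hfin.subset hsub).eq_of_subset_of_encard_le hsub ?_).symm
  rw [Set.encard_eq_three.2 ⟨t, m, b, ?_, ?_, ?_, rfl⟩]
  · exact hcard
  all_goals rintro rfl; omega

theorem reachable_of_reflTransGen
    (D : LevelData H.outerFace Set.univ H.graph H.innerFaces ℓ R) {p q : V} {i : ℕ}
    (h : Relation.ReflTransGen (fun s t => H.graph.Adj s t ∧ ℓ s = i ∧ ℓ t = i) p q)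
    (hp : p ∈ H.level i) (hq : q ∈ H.level i) :
    (H.levelGraph i).Reachable ⟨p, hp⟩ ⟨q, hq⟩ := by
  induction h with
  | refl => exact SimpleGraph.Reachable.refl _
  | @tail s t _ h ih =>
    have hs := (mem_level_iff D).2 h.2.1
    refine (ih hs).trans (SimpleGraph.Adj.reachable ?_)
    exact h.1

theorem connectedComponentMk_eq_iff
    (D : LevelData H.outerFace Set.univ H.graph H.innerFaces ℓ R) {j : ℕ}
    {v w : H.level (j + 1)} :
    (H.levelGraph (j + 1)).connectedComponentMk v = (H.levelGraph (j + 1)).connectedComponentMk w ↔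
      R j v = R j w := by
  have hlev : ∀ p : H.level (j + 1), ℓ p = j + 1 := fun p => (mem_level_iff D).1 p.2
  rw [SimpleGraph.ConnectedComponent.eq]
  constructor
  · rintro ⟨p⟩
    induction p with
    | nil => rfl
    | @cons a b c h p ih =>
      have ha := hlev a
      have hb := hlev b
      have hab : H.graph.Adj a b := h
      exact (D.region_eq hab (by omega) (by omega)).trans ih
  · intro h
    exact reachable_of_reflTransGen D (D.connected (Set.mem_univ _) (Set.mem_univ _) (hlev v)
      (hlev w) h) v.2 w.2

theorem region_eq_of_residence_eq
    (D : LevelData H.outerFace Set.univ H.graph H.innerFaces ℓ R) {j : ℕ} {v w : V}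
    (hv : j < ℓ v) (hw : j < ℓ w) (h : H.residence j v = H.residence j w) : R j v = R j w := by
  obtain ⟨f, hf, hvf⟩ := D.exists_face (Set.mem_univ v)
  have hres : f ∈ H.residence j v := ⟨f, Or.inr hf, hvf, Relation.ReflTransGen.refl⟩
  rcases region_of_mem_residence D hw (h ▸ hres) v hvf with h | h
  · exact h.2
  · exact absurd h.1 (ne_of_gt hv)

/-- A component is determined by its region, hence by the pair completing `u` to that region. -/
theorem encard_components_le (D : LevelData H.outerFace Set.univ H.graph H.innerFaces ℓ R)
    {j : ℕ} (u : V) (N : Set (H.level (j + 1))) (S : Finset (V × V))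
    (h : ∀ v ∈ N, ∃ q ∈ S, R j v = {u, q.1, q.2}) :
    ((H.levelGraph (j + 1)).connectedComponentMk '' N).encard ≤ S.card := by
  have : Nonempty (V × V) := ⟨(u, u)⟩
  have key : ∀ C ∈ (H.levelGraph (j + 1)).connectedComponentMk '' N, ∃ q ∈ S, ∃ v,
      (H.levelGraph (j + 1)).connectedComponentMk v = C ∧ R j v = {u, q.1, q.2} := by
    rintro _ ⟨v, hv, rfl⟩
    obtain ⟨q, hq, h⟩ := h v hv
    exact ⟨q, hq, v, rfl, h⟩
  choose! φ hφ hφ' using key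
  rw [← Set.encard_coe_eq_coe_finsetCard]
  refine Set.encard_le_encard_of_injOn (f := φ) hφ fun C hC C' hC' hCC' => ?_
  obtain ⟨v, rfl, h1⟩ := hφ' C hC
  obtain ⟨w, rfl, h2⟩ := hφ' C' hC'
  rw [connectedComponentMk_eq_iff D, h1, h2, hCC']

end MaximalPlane3Tree

/-! ### The layout and the conclusion. -/

namespace PeelingLayout

variable {V : Type*} {H : MaximalPlane3Tree V} (Γ : PeelingLayout H)

/-- A clique of `L_j` through `u` stays in the component of `u`, so one drawing contains all the
face triangles at `u`. -/
theorem exists_drawing {j : ℕ} {u : V} (hu : u ∈ H.level j) :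
    ∃ env G, EnvelopeDrawing Γ.x Γ.y env G ∧
      ∀ T : Set V, H.graph.IsClique T → u ∈ T → (∀ p ∈ T, p ∈ H.level j) → G.IsClique T := by
  obtain ⟨env, G, hE, hmem, hadj⟩ := Γ.drawing j ((H.levelGraph j).connectedComponentMk ⟨u, hu⟩)
  refine ⟨env, G, hE, fun T hT huT hlev => ?_⟩
  have henv : ∀ p ∈ T, p ∈ env := by
    intro p hp
    refine (hmem p).2 ⟨hlev p hp, ?_⟩
    by_cases hpu : p = u
    · subst hpu; rfl
    · refine SimpleGraph.ConnectedComponent.eq.2 (SimpleGraph.Adj.reachable ?_)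
      exact hT hp huT hpu
  exact fun p hp q hq hpq => hadj p (henv p hp) q (henv q hq) (hT hp hq hpq)

end PeelingLayout

theorem lemma3 {V : Type*} (H : MaximalPlane3Tree V) (Γ : PeelingLayout H) (j : ℕ) (u : V)
    (hu : u ∈ H.level j) :
    (∀ v ∈ Γ.N 3 j u, ∀ w ∈ Γ.N 2 j u, Γ.prec v w) ∧
    ((H.levelGraph (j + 1)).connectedComponentMk '' Γ.N 2 j u).encard ≤ 2 ∧
    ((H.levelGraph (j + 1)).connectedComponentMk '' Γ.N 3 j u).encard ≤ 2 ∧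
    (∀ v ∈ Γ.N 2 j u ∪ Γ.N 3 j u, ∀ w ∈ Γ.N 2 j u ∪ Γ.N 3 j u,
      (H.levelGraph (j + 1)).connectedComponentMk v ≠ (H.levelGraph (j + 1)).connectedComponentMk w →
      H.residence j v ≠ H.residence j w) := by
  obtain ⟨ℓ, R, D⟩ := H.exists_levelData
  have hlt : ∀ v : H.level (j + 1), j < ℓ v := fun v => by
    rw [(MaximalPlane3Tree.mem_level_iff D).1 v.2]; exact Nat.lt_succ_self j
  have hlevel : ∀ i, u ∈ H.level i → i = j := fun i hi =>
    ((MaximalPlane3Tree.mem_level_iff D).1 hi).symm.trans ((MaximalPlane3Tree.mem_level_iff D).1 hu)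
  have top : ∀ v ∈ Γ.N 2 j u, ∃ m b, H.FaceRoles Γ.y j v u m b := by
    rintro v ⟨-, i, hi, -, h⟩
    obtain rfl := hlevel i hi
    exact h
  have middle : ∀ v ∈ Γ.N 3 j u, ∃ t b, H.FaceRoles Γ.y j v t u b := by
    rintro v ⟨-, i, hi, -, h⟩
    obtain rfl := hlevel i hi
    exact h
  have boundary : ∀ (v : H.level (j + 1)) (t m b : V), H.FaceRoles Γ.y j v t m b →
      H.graph.IsClique {t, m, b} ∧ ∀ p ∈ ({t, m, b} : Set V), p ∈ H.level j := by
    intro v t m b h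
    refine ⟨?_, fun p hp => ?_⟩
    · rw [← MaximalPlane3Tree.region_eq_of_faceRoles D v.2 h]
      exact D.region_clique (Set.mem_univ _) (hlt v)
    · rw [← h.1] at hp
      exact hp.1
  obtain ⟨env, G, hE, hG⟩ := Γ.exists_drawing hu
  refine ⟨?_, ?_, ?_, ?_⟩
  · intro v hv w hw
    obtain ⟨t, b, hvf⟩ := middle v hv
    obtain ⟨m, b', hwf⟩ := top w hw
    have hRv := MaximalPlane3Tree.region_eq_of_faceRoles D v.2 hvf
    have hRw := MaximalPlane3Tree.region_eq_of_faceRoles D w.2 hwf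
    obtain ⟨-, htu, hub⟩ := id hvf
    obtain ⟨-, hum, hmb⟩ := id hwf
    -- The region of `v` contains `t`, which is higher than `u`, while `u` is the highest vertex in
    -- the region of `w`.
    have hne : ¬ H.SameComponent (j + 1) v w := by
      rintro ⟨_, _, hr⟩
      have hR := (MaximalPlane3Tree.connectedComponentMk_eq_iff D (v := v) (w := w)).1
        (SimpleGraph.ConnectedComponent.eq.2 hr)
      have ht : t ∈ ({u, m, b'} : Set V) := by rw [← hRw, ← hR, hRv]; simp
      rcases ht with rfl | rfl | rfl <;> omega
    rw [Γ.prec_iff_of_not_sameComponent j v w t u b u m b' v.2 w.2 hne hvf hwf]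
    left
    obtain ⟨hcl, hlev⟩ := boundary w u m b' hwf
    have hm : m ∈ H.level j := hlev m (by simp)
    have hadj : H.graph.Adj u m := hcl (by simp) (by simp) (by rintro rfl; omega)
    rw [Γ.prec_iff_of_sameComponent j u m ⟨hu, hm, SimpleGraph.Adj.reachable hadj⟩]
    left
    omega
  · obtain ⟨S, hS, hcard⟩ := hE.exists_finset_top u
    refine (MaximalPlane3Tree.encard_components_le D u _ S fun v hv => ?_).trans
      (by exact_mod_cast hcard)
    obtain ⟨m, b, h⟩ := top v hv
    obtain ⟨hcl, hlev⟩ := boundary v u m b h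
    have hT := hG _ hcl (by simp) hlev
    obtain ⟨-, hum, hmb⟩ := id h
    refine ⟨(m, b), hS ⟨hT (by simp) (by simp) ?_, hT (by simp) (by simp) ?_,
      hT (by simp) (by simp) ?_, ?_, ?_⟩, MaximalPlane3Tree.region_eq_of_faceRoles D v.2 h⟩
    · rintro rfl; omega
    · rintro rfl; omega
    · intro e; simp only at e; subst e; omega
    · simp only; omega
    · simp only; omega
  · obtain ⟨S, hS, hcard⟩ := hE.exists_finset_middle u
    refine (MaximalPlane3Tree.encard_components_le D u _ S fun v hv => ?_).trans
      (by exact_mod_cast hcard)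
    obtain ⟨t, b, h⟩ := middle v hv
    obtain ⟨hcl, hlev⟩ := boundary v t u b h
    have hT := hG _ hcl (by simp) hlev
    obtain ⟨-, htu, hub⟩ := id h
    refine ⟨(t, b), hS ⟨hT (by simp) (by simp) ?_, hT (by simp) (by simp) ?_,
      hT (by simp) (by simp) ?_, ?_, ?_⟩, ?_⟩
    · rintro rfl; omega
    · rintro rfl; omega
    · intro e; simp only at e; subst e; omega
    · simp only; omega
    · simp only; omega
    · rw [MaximalPlane3Tree.region_eq_of_faceRoles D v.2 h, Set.insert_comm]
  · intro v _ w _ hvw h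
    exact hvw ((MaximalPlane3Tree.connectedComponentMk_eq_iff D).2
      (MaximalPlane3Tree.region_eq_of_residence_eq D (hlt v) (hlt w) h))
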